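/- Let $T$ be a tree (a connected simple graph without cycles, not assumed locally finite) and equip $\operatorname{Aut} T$ with the permutation topology, in which the pointwise stabilizers of finite sets of vertices form a neighbourhood basis of the identity. A half-tree of $T$ is a component of $T\setminus\{e\}$, for an edge $e$ of $T$ such that both components of $T\setminus\{e\}$ are infinite. An end of $T$ is an equivalence class of rays (infinite sequences of distinct vertices, consecutive ones adjacent), where two rays are equivalent if some ray contains infinitely many vertices of both. For a subgroup $G$ of $\operatorname{Aut} T$ let $G^{++}$ be the closure of the subgroup generated by the pointwise stabilizers in $G$ of all half-trees of $T$; $G$ has property H if the pointwise stabilizer in $G$ of every half-tree of $T$ is non-trivial. Let $G$ be a closed subgroup of $\operatorname{Aut} T$ such that no proper non-empty subtree of $T$ is invariant under $G$, no end of $T$ is fixed by $G$, and $G$ has property H. If $N$ is a non-trivial closed subgroup of $G$ normalized by $G^{++}$, then $N$ contains $G^{++}$. In particular, if $T$ is infinite, then $G^{++}$ is topologically simple, that is, $G^{++}$ is non-trivial and its only closed normal subgroups are $\{1\}$ and $G^{++}$. -/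

import Mathlib

namespace TreeAut

variable {V : Type*} {T : SimpleGraph V}

/-- The permutation topology on the automorphism group of a graph, that is, the topology of
pointwise convergence on the vertex set, the vertex set being discrete. The pointwise stabilizers
of finite sets of vertices form a neighbourhood basis of the identity. -/
instance permutationTopology : TopologicalSpace (T ≃g T) :=
  TopologicalSpace.induced (fun g : T ≃g T => (g : V → V))
    (@Pi.topologicalSpace V (fun _ => V) (fun _ => ⊥))

theorem continuous_iff_isOpen {X : Type*} [TopologicalSpace X] (f : X → (T ≃g T)) :
    Continuous f ↔ ∀ v w : V, IsOpen {x | f x v = w} := by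
  let _ : TopologicalSpace V := ⊥
  have _ : DiscreteTopology V := ⟨rfl⟩
  rw [continuous_induced_rng, continuous_pi_iff]
  refine forall_congr' fun v => ?_
  rw [continuous_discrete_rng]
  rfl

theorem isOpen_apply_eq (v w : V) : IsOpen {g : T ≃g T | g v = w} :=
  (continuous_iff_isOpen (fun g : T ≃g T => g)).1 continuous_id v w

instance isTopologicalGroup : IsTopologicalGroup (T ≃g T) where
  continuous_mul := by
    rw [continuous_iff_isOpen]
    intro v w
    have h : {x : (T ≃g T) × (T ≃g T) | (x.1 * x.2) v = w} =
        ⋃ u : V, {g : T ≃g T | g u = w} ×ˢ {g : T ≃g T | g v = u} := by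
      ext x
      simp
    rw [h]
    exact isOpen_iUnion fun u => (isOpen_apply_eq u w).prod (isOpen_apply_eq v u)
  continuous_inv := by
    rw [continuous_iff_isOpen]
    intro v w
    have h : {g : T ≃g T | g⁻¹ v = w} = {g : T ≃g T | g w = v} := by
      ext g
      exact g.toEquiv.symm_apply_eq.trans eq_comm
    rw [h]
    exact isOpen_apply_eq w v

/-- `G` leaves the subgraph `S` of `T` invariant. -/
def LeavesInvariant (G : Subgroup (T ≃g T)) (S : T.Subgraph) : Prop :=
  ∀ g ∈ G, S.map (g : T →g T) = S

/-- No proper non-empty subtree of `T` is invariant under `G`. (`IsTree` includes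
non-emptiness.) -/
def NoProperInvariantSubtree (G : Subgroup (T ≃g T)) : Prop :=
  ∀ S : T.Subgraph, S.coe.IsTree → LeavesInvariant G S → S = ⊤

/-- A ray: an infinite sequence of distinct vertices, consecutive ones being adjacent. -/
structure Ray (T : SimpleGraph V) where
  /-- The vertices of the ray. -/
  vert : ℕ → V
  injective : Function.Injective vert
  adj : ∀ i, T.Adj (vert i) (vert (i + 1))

/-- The image of a ray under an automorphism. -/
def Ray.map (g : T ≃g T) (r : Ray T) : Ray T where
  vert i := g (r.vert i)
  injective := g.injective.comp r.injective
  adj i := g.map_rel_iff.2 (r.adj i)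

/-- Two rays belong to the same end if some third ray contains infinitely many vertices of
both. -/
def Ray.SameEnd (r s : Ray T) : Prop :=
  ∃ t : Ray T, (Set.range t.vert ∩ Set.range r.vert).Infinite ∧
    (Set.range t.vert ∩ Set.range s.vert).Infinite

/-- `G` fixes an end of `T`: the end of some ray `r` is fixed by all elements of `G`. -/
def FixesEnd (G : Subgroup (T ≃g T)) : Prop :=
  ∃ r : Ray T, ∀ g ∈ G, (r.map g).SameEnd r

/-- `A` is (the vertex set of) a half-tree of `T`: one of the components of `T` minus an edge `e`,
all components of `T` minus `e` being infinite. -/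
def IsHalfTree (T : SimpleGraph V) (A : Set V) : Prop :=
  ∃ e ∈ T.edgeSet,
    (∃ C : (T.deleteEdges {e}).ConnectedComponent, C.supp = A) ∧
    ∀ D : (T.deleteEdges {e}).ConnectedComponent, D.supp.Infinite

/-- The pointwise stabilizer in `G` of a set of vertices. -/
def pointwiseStabilizer (G : Subgroup (T ≃g T)) (A : Set V) : Subgroup (T ≃g T) where
  carrier := {g | g ∈ G ∧ ∀ a ∈ A, g a = a}
  one_mem' := ⟨G.one_mem, fun _ _ => rfl⟩
  mul_mem' := fun {g h} hg hh => ⟨G.mul_mem hg.1 hh.1, fun a ha => by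
    rw [RelIso.mul_apply, hh.2 a ha, hg.2 a ha]⟩
  inv_mem' := fun {g} hg => ⟨G.inv_mem hg.1, fun a ha =>
    g.toEquiv.symm_apply_eq.2 (hg.2 a ha).symm⟩

/-- Property H: the pointwise stabilizer of every half-tree is non-trivial. -/
def PropertyH (G : Subgroup (T ≃g T)) : Prop :=
  ∀ A : Set V, IsHalfTree T A → pointwiseStabilizer G A ≠ ⊥

/-- The group `G⁺⁺`: the closure of the subgroup generated by the pointwise stabilizers in `G` of
all half-trees. -/
def plusPlus (G : Subgroup (T ≃g T)) : Subgroup (T ≃g T) :=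
  (Subgroup.closure {g | ∃ A : Set V, IsHalfTree T A ∧ g ∈ pointwiseStabilizer G A}).topologicalClosure

/-- A topological group is topologically simple if it is non-trivial and its only closed normal
subgroups are the trivial one and the whole group. -/
def IsTopologicallySimple (G : Type*) [Group G] [TopologicalSpace G] : Prop :=
  Nontrivial G ∧ ∀ N : Subgroup G, N.Normal → IsClosed (N : Set G) → N = ⊥ ∨ N = ⊤

end TreeAut

/-! Call a subgroup flipping (`FlipsSides`) if for every edge, each of its two sides is carried off
itself by some element; it then carries any side into any other (`FlipsSides.exists_side_subset`).
If `G` were not flipping, the translates of some side would meet pairwise and point towards a fixed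
end. Flipping passes to non-trivial subgroups `N` normalized by a flipping group
(`FlipsSides.of_ne_bot`): property H provides branch vertices, a non-trivial element moves one of
them, hence carries some side off itself, and conjugation spreads this to all edges. So `G`, then
`halfTreeSubgroup G`, then `N` are flipping. Finally let `g` fix a half-tree pointwise and let `F`
be finite. Some `n ∈ N` carries the complementary half-tree into a side missing `F`. Then `n * g⁻¹ *
n⁻¹` fixes `F`, so the commutator of `g` and `n` lies in `N` and agrees with `g` on `F`. As `N` is
closed, `g ∈ N`. -/

namespace TreeAut

open SimpleGraph

variable {V : Type*} {T : SimpleGraph V}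

/-! ### Sides of edges and their nesting -/

/-- The component containing `u` of the graph `T` minus the edge `uv`. -/
def side (T : SimpleGraph V) (u v : V) : Set V :=
  {x | (T.deleteEdges {s(u, v)}).Reachable u x}

theorem left_mem_side (u v : V) : u ∈ side T u v := Reachable.refl u

/-- The only edge leaving `side T u v` is `uv`. -/
theorem mem_side_of_adj {u v x y : V} (hx : x ∈ side T u v) (hxy : T.Adj x y) :
    y ∈ side T u v ∨ (x = u ∧ y = v) ∨ (x = v ∧ y = u) := by
  by_cases h : s(x, y) = s(u, v)
  · right
    simpa using h
  · left
    have : (T.deleteEdges {s(u, v)}).Adj x y := by simpa using ⟨hxy, by simpa using h⟩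
    exact Reachable.trans hx this.reachable

theorem right_notMem_side (hT : T.IsTree) {u v : V} (h : T.Adj u v) : v ∉ side T u v :=
  isAcyclic_iff_forall_adj_isBridge.1 hT.isAcyclic h

/-- Induction along the side of an edge. -/
theorem side_induction {u v : V} {P : V → Prop} (h0 : P u)
    (hs : ∀ x y, x ∈ side T u v → y ∈ side T u v → T.Adj x y → P x → P y) :
    ∀ x ∈ side T u v, P x := by
  rintro x hx
  have hx' := (reachable_iff_reflTransGen _ _).1 hx
  induction hx' with
  | refl => exact h0
  | tail hab hbc ih =>
    have hb := (reachable_iff_reflTransGen _ _).2 hab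
    exact hs _ _ hb hx ((deleteEdges_le _) hbc) (ih hb)

/-- Induction along the edges of a connected graph. -/
theorem adj_induction (hT : T.IsTree) {P : V → Prop} (u : V) (h0 : P u)
    (hs : ∀ x y, T.Adj x y → P x → P y) (x : V) : P x := by
  have hx' := (reachable_iff_reflTransGen _ _).1 (hT.connected.preconnected u x)
  induction hx' with
  | refl => exact h0
  | tail hab hbc ih => exact hs _ _ hbc ih

theorem mem_side_or (hT : T.IsTree) (u v x : V) : x ∈ side T u v ∨ x ∈ side T v u := by
  refine adj_induction hT (P := fun x => x ∈ side T u v ∨ x ∈ side T v u) u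
    (Or.inl (left_mem_side u v)) ?_ x
  rintro x y hxy (hx | hx)
  · rcases mem_side_of_adj hx hxy with h | ⟨_, rfl⟩ | ⟨_, rfl⟩
    · exact Or.inl h
    · exact Or.inr (left_mem_side _ _)
    · exact Or.inl (left_mem_side _ _)
  · rcases mem_side_of_adj hx hxy with h | ⟨_, rfl⟩ | ⟨_, rfl⟩
    · exact Or.inr h
    · exact Or.inl (left_mem_side _ _)
    · exact Or.inr (left_mem_side _ _)

theorem notMem_side_of_mem (hT : T.IsTree) {u v x : V} (h : T.Adj u v) (hx : x ∈ side T u v) :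
    x ∉ side T v u := by
  intro hx'
  refine right_notMem_side hT h (Reachable.trans hx ?_)
  have h' : (T.deleteEdges {s(v, u)}).Reachable v x := hx'
  rw [Sym2.eq_swap] at h'
  exact h'.symm

theorem mem_side_swap_iff (hT : T.IsTree) {u v x : V} (h : T.Adj u v) :
    x ∈ side T v u ↔ x ∉ side T u v :=
  ⟨notMem_side_of_mem hT h.symm, fun hx => (mem_side_or hT u v x).resolve_left hx⟩

/-- An edge that leaves `side T u v` is the edge `uv`. -/
theorem eq_of_adj_of_mem_side (hT : T.IsTree) {u v x y : V} (h : T.Adj u v)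
    (hx : x ∈ side T u v) (hy : y ∉ side T u v) (hxy : T.Adj x y) : x = u ∧ y = v := by
  rcases mem_side_of_adj hx hxy with h' | h' | ⟨rfl, _⟩
  · exact absurd h' hy
  · exact h'
  · exact absurd hx (right_notMem_side hT h)

/-- If `side T w z` starts inside `side T u v` and does not contain `v`, then it is contained in
`side T u v`. -/
theorem side_subset_side (hT : T.IsTree) {u v w z : V} (h : T.Adj u v)
    (hv : v ∉ side T w z) (hw : w ∈ side T u v) : side T w z ⊆ side T u v := by
  refine side_induction hw fun x y _ hy hxy hxu => ?_
  by_contra hyu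
  obtain ⟨_, rfl⟩ := eq_of_adj_of_mem_side hT h hxu hyu hxy
  exact hv hy

/-- Sides of distinct edges pointing away from a common vertex are nested. -/
theorem side_subset_of_ne (hT : T.IsTree) {u v w : V} (h : T.Adj u v) (hw : T.Adj w u)
    (hne : w ≠ v) : side T w u ⊆ side T u v := by
  have hv : v ∉ side T w u := fun hv =>
    hne (eq_of_adj_of_mem_side hT hw hv (right_notMem_side hT hw) h.symm).1.symm
  refine side_subset_side hT h hv ?_
  by_contra hwu
  exact hne (eq_of_adj_of_mem_side hT h (left_mem_side u v) hwu hw.symm).2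

theorem eq_of_mem_side_of_mem_side (hT : T.IsTree) {u v w x : V} (hv : T.Adj v u)
    (hw : T.Adj w u) (hxv : x ∈ side T v u) (hxw : x ∈ side T w u) : v = w := by
  by_contra hne
  exact notMem_side_of_mem hT hv hxv
    (side_subset_of_ne hT hv.symm hw (Ne.symm hne) hxw)

theorem exists_adj_mem_side (hT : T.IsTree) {u x : V} (hne : x ≠ u) :
    ∃ w, T.Adj w u ∧ x ∈ side T w u := by
  have key : ∀ x, x = u ∨ ∃ w, T.Adj w u ∧ x ∈ side T w u := by
    refine adj_induction hT u (Or.inl rfl) ?_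
    rintro x y hxy (rfl | ⟨w, hw, hx⟩)
    · exact Or.inr ⟨y, hxy.symm, left_mem_side _ _⟩
    · by_cases hy : y ∈ side T w u
      · exact Or.inr ⟨w, hw, hy⟩
      · exact Or.inl (eq_of_adj_of_mem_side hT hw hx hy hxy).2
  exact (key x).resolve_left hne

/-- Any two edges have nested sides. -/
theorem side_nested (hT : T.IsTree) {u v a b : V} (h : T.Adj u v) (hab : T.Adj a b) :
    side T u v ⊆ side T a b ∨ side T u v ⊆ side T b a ∨
      side T v u ⊆ side T a b ∨ side T v u ⊆ side T b a := by
  -- Up to swapping `u` and `v`, `a ∈ side T u v`; then `side T v u` lies in whichever side of `ab`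
  -- contains `v`.
  have key : ∀ {u v a b : V}, T.Adj u v → T.Adj a b → a ∈ side T u v →
      side T v u ⊆ side T a b ∨ side T v u ⊆ side T b a := by
    intro u v a b h hab ha
    have ha' := notMem_side_of_mem hT h ha
    rcases mem_side_or hT a b v with hv | hv
    · by_cases hb : b ∈ side T v u
      · obtain ⟨rfl, rfl⟩ := eq_of_adj_of_mem_side hT h ha ((mem_side_swap_iff hT h).1 hb) hab
        exact Or.inr subset_rfl
      · exact Or.inl (side_subset_side hT hab hb hv)
    · exact Or.inr (side_subset_side hT hab.symm ha' hv)
  rcases mem_side_or hT u v a with ha | ha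
  · rcases key h hab ha with h | h <;> simp [h]
  · rcases key h.symm hab ha with h | h <;> simp [h]

theorem apply_adj (g : T ≃g T) {x y : V} (h : T.Adj x y) : T.Adj (g x) (g y) :=
  g.map_rel_iff.2 h

theorem apply_mem_side_of_mem (g : T ≃g T) {u v x : V} (hx : x ∈ side T u v) :
    g x ∈ side T (g u) (g v) := by
  let f : T.deleteEdges {s(u, v)} →g T.deleteEdges {s(g u, g v)} :=
    { toFun := g
      map_rel' := by
        intro a b hab
        rw [deleteEdges_adj] at hab ⊢
        exact ⟨apply_adj g hab.1, by simpa using hab.2⟩ }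
  exact Reachable.map f hx

theorem apply_mem_side_iff (g : T ≃g T) {u v x : V} :
    g x ∈ side T (g u) (g v) ↔ x ∈ side T u v := by
  refine ⟨fun h => ?_, apply_mem_side_of_mem g⟩
  simpa using apply_mem_side_of_mem g⁻¹ h

theorem mem_side_apply_iff (g : T ≃g T) {u v x : V} :
    x ∈ side T (g u) (g v) ↔ g⁻¹ x ∈ side T u v := by
  rw [← apply_mem_side_iff g (x := g⁻¹ x), RelIso.apply_inv_self]

theorem side_apply_subset (g : T ≃g T) {u v a b : V} (h : side T u v ⊆ side T a b) :
    side T (g u) (g v) ⊆ side T (g a) (g b) := fun x hx => by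
  rw [mem_side_apply_iff] at hx ⊢
  exact h hx

/-- Sides of edges are convex. -/
theorem support_subset_side (hT : T.IsTree) {u v x y : V} (hx : x ∈ side T u v)
    (hy : y ∈ side T u v) (p : T.Walk x y) (hp : p.IsPath) {z : V} (hz : z ∈ p.support) :
    z ∈ side T u v := by
  classical
  obtain ⟨q, hq⟩ := (Reachable.trans (Reachable.symm hx) hy).exists_isPath
  have hle : T.deleteEdges {s(u, v)} ≤ T := deleteEdges_le _
  have hpq : p = q.mapLe hle :=
    (hT.existsUnique_path x y).unique hp (hq.mapLe hle)
  rw [hpq, Walk.support_mapLe_eq_support] at hz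
  exact Reachable.trans hx (q.takeUntil z hz).reachable

/-! ### Consequences of having no proper invariant subtree -/

/-- A convex non-empty invariant set of vertices is everything, if there is no proper invariant
subtree. -/
theorem mem_of_convex_of_invariant (hT : T.IsTree) {G : Subgroup (T ≃g T)}
    (hsub : NoProperInvariantSubtree G) {W : Set V} (hne : W.Nonempty)
    (hW : ∀ x ∈ W, ∀ y ∈ W, ∀ p : T.Walk x y, p.IsPath → ∀ z ∈ p.support, z ∈ W)
    (hinv : ∀ g ∈ G, ∀ x ∈ W, g x ∈ W) (v : V) : v ∈ W := by
  have htree : ((⊤ : T.Subgraph).induce W).coe.IsTree := by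
    refine ⟨?_, hT.isAcyclic.subgraph _⟩
    rw [← Subgraph.connected_iff', ← connected_induce_iff]
    have : Nonempty W := hne.to_subtype
    refine Connected.mk fun x y => ?_
    obtain ⟨p, hp, -⟩ := hT.existsUnique_path x y
    exact (p.induce W (hW x x.2 y y.2 p hp)).reachable
  have hLI : LeavesInvariant G ((⊤ : T.Subgraph).induce W) := by
    intro g hg
    have himg : ∀ x, (∃ y ∈ W, g y = x) ↔ x ∈ W := fun x =>
      ⟨by rintro ⟨y, hy, rfl⟩; exact hinv g hg y hy,
        fun hx => ⟨g⁻¹ x, hinv _ (G.inv_mem hg) x hx, RelIso.apply_inv_self g x⟩⟩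
    ext x y
    · exact himg x
    · simp only [Subgraph.map_adj, Relation.Map, Subgraph.induce_adj, Subgraph.top_adj]
      constructor
      · rintro ⟨a, b, ⟨ha, hb, hab⟩, rfl, rfl⟩
        exact ⟨hinv g hg a ha, hinv g hg b hb, apply_adj g hab⟩
      · rintro ⟨hx, hy, hxy⟩
        exact ⟨g⁻¹ x, g⁻¹ y, ⟨hinv _ (G.inv_mem hg) x hx, hinv _ (G.inv_mem hg) y hy,
          apply_adj g⁻¹ hxy⟩, RelIso.apply_inv_self g x, RelIso.apply_inv_self g y⟩
  have htop := hsub _ htree hLI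
  have : v ∈ (⊤ : T.Subgraph).verts := trivial
  rwa [← htop] at this

theorem exists_apply_notMem_side (hT : T.IsTree) {G : Subgroup (T ≃g T)}
    (hsub : NoProperInvariantSubtree G) {u v : V} (h : T.Adj u v) (x : V) :
    ∃ g ∈ G, g x ∉ side T u v := by
  by_contra! hx
  -- The intersection of all translates of the side is convex and invariant, but misses `v`.
  have key := mem_of_convex_of_invariant hT hsub (W := {y | ∀ g ∈ G, g y ∈ side T u v}) ⟨x, hx⟩
    (fun y hy z hz p hp t ht g hg => by
      refine support_subset_side hT (hy g hg) (hz g hg) (p.map (g : T →g T))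
        (hp.map g.injective) ?_
      rw [Walk.support_map]
      exact List.mem_map_of_mem ht)
    (fun g hg y hy k hk => hy (k * g) (G.mul_mem hk hg)) v
  exact right_notMem_side hT h (key 1 G.one_mem)

theorem exists_apply_mem_side (hT : T.IsTree) {G : Subgroup (T ≃g T)}
    (hsub : NoProperInvariantSubtree G) {u v : V} (h : T.Adj u v) (x : V) :
    ∃ g ∈ G, g x ∈ side T u v := by
  obtain ⟨g, hg, hgx⟩ := exists_apply_notMem_side hT hsub h.symm x
  exact ⟨g, hg, (mem_side_swap_iff hT h.symm).2 hgx⟩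

/-- An infinite tree without a proper invariant subtree has no leaves. -/
theorem exists_adj_ne (hT : T.IsTree) [Infinite V] {G : Subgroup (T ≃g T)}
    (hsub : NoProperInvariantSubtree G) {u v : V} (h : T.Adj u v) :
    ∃ w, T.Adj w u ∧ w ≠ v := by
  by_contra! hu
  have hside : ∀ x ∈ side T u v, x = u := by
    refine side_induction rfl ?_
    rintro x y - hy hxy rfl
    rw [hu y hxy.symm] at hy
    exact absurd hy (right_notMem_side hT h)
  -- The side is now `{u}`, so `G` moves every vertex to the leaf `u`; hence every vertex is a leaf.
  have hleaf : ∀ x y z, T.Adj y x → T.Adj z x → y = z := by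
    intro x y z hy hz
    obtain ⟨g, -, hgx⟩ := exists_apply_mem_side hT hsub h x
    have hgx := hside _ hgx
    apply g.injective
    rw [hu (g y) (hgx ▸ apply_adj g hy), hu (g z) (hgx ▸ apply_adj g hz)]
  have hall : ∀ x, x = u ∨ x = v := by
    refine adj_induction hT u (Or.inl rfl) ?_
    rintro x y hxy (rfl | rfl)
    · exact Or.inr (hu y hxy.symm)
    · exact Or.inl (hleaf _ _ _ hxy.symm h)
  refine Set.infinite_univ (α := V) ((Set.toFinite {u, v}).subset fun x _ => ?_)
  simpa using hall x

/-- Without leaves every side properly contains another one, so a finite side would start an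
infinite descent. -/
theorem side_infinite (hT : T.IsTree) [Infinite V] {G : Subgroup (T ≃g T)}
    (hsub : NoProperInvariantSubtree G) {u v : V} (h : T.Adj u v) : (side T u v).Infinite := by
  intro hfin
  induction hn : (side T u v).ncard using Nat.strong_induction_on generalizing u v with
  | _ n ih =>
    obtain ⟨w, hw, hne⟩ := exists_adj_ne hT hsub h
    have hss := side_subset_of_ne hT h hw hne
    refine ih _ ?_ hw (hfin.subset hss) rfl
    rw [← hn]
    exact Set.ncard_lt_ncard
      ⟨hss, fun hle => right_notMem_side hT hw (hle (left_mem_side u v))⟩ hfin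

theorem exists_adj (hT : T.IsTree) [Infinite V] : ∃ u v, T.Adj u v := by
  obtain ⟨x, y, hxy⟩ := exists_pair_ne V
  obtain ⟨w, hw, -⟩ := exists_adj_mem_side hT hxy
  exact ⟨w, y, hw⟩

theorem supp_eq_side (hT : T.IsTree) {u v : V}
    (C : (T.deleteEdges {s(u, v)}).ConnectedComponent) :
    C.supp = side T u v ∨ C.supp = side T v u := by
  induction C using ConnectedComponent.ind with
  | _ x =>
    rcases mem_side_or hT u v x with hx | hx
    · left
      ext y
      rw [ConnectedComponent.mem_supp_iff, ConnectedComponent.eq]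
      exact ⟨fun hy => Reachable.trans hx hy.symm, fun hy => (Reachable.symm hy).trans hx⟩
    · right
      have hx' : (T.deleteEdges {s(v, u)}).Reachable v x := hx
      rw [Sym2.eq_swap] at hx'
      ext y
      rw [ConnectedComponent.mem_supp_iff, ConnectedComponent.eq, side, Sym2.eq_swap (a := v)]
      exact ⟨fun hy => hx'.trans hy.symm, fun hy => (Reachable.symm hy).trans hx'⟩

theorem IsHalfTree.exists_eq_side (hT : T.IsTree) {A : Set V} (hA : IsHalfTree T A) :
    ∃ u v, T.Adj u v ∧ A = side T u v := by
  obtain ⟨e, he, ⟨C, rfl⟩, -⟩ := hA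
  induction e using Sym2.ind with
  | _ u v =>
    rcases supp_eq_side hT C with h | h
    · exact ⟨u, v, he, h⟩
    · exact ⟨v, u, SimpleGraph.Adj.symm he, h⟩

theorem isHalfTree_side (hT : T.IsTree) [Infinite V] {G : Subgroup (T ≃g T)}
    (hsub : NoProperInvariantSubtree G) {u v : V} (h : T.Adj u v) :
    IsHalfTree T (side T u v) := by
  refine ⟨s(u, v), h, ⟨(T.deleteEdges {s(u, v)}).connectedComponentMk u, ?_⟩, fun D => ?_⟩
  · ext y
    rw [ConnectedComponent.mem_supp_iff, ConnectedComponent.eq]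
    exact ⟨fun hy => hy.symm, fun hy => Reachable.symm hy⟩
  · rcases supp_eq_side hT D with hD | hD <;> rw [hD]
    · exact side_infinite hT hsub h
    · exact side_infinite hT hsub h.symm

/-! ### Fixed ends and flipping -/

theorem side_subset_of_mem (hT : T.IsTree) {w z x y t : V} (hy : T.Adj y x)
    (hx : x ∉ side T w z) (ht : t ∈ side T w z) (hty : t ∈ side T y x) :
    side T w z ⊆ side T y x := by
  have hne : w ≠ x := by
    rintro rfl
    exact hx (left_mem_side _ _)
  obtain ⟨y', hy', hw⟩ := exists_adj_mem_side hT hne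
  have hss := side_subset_side hT hy' hx hw
  rwa [eq_of_mem_side_of_mem_side hT hy hy' hty (hss ht)]

/-- Iterating a map that moves every vertex to a neighbour and never backtracks gives a ray. -/
theorem injective_iterate (hT : T.IsTree) {f : V → V} (hadj : ∀ x, T.Adj (f x) x)
    (hne : ∀ x, f (f x) ≠ x) (x : V) : Function.Injective fun i : ℕ => f^[i] x := by
  have hmono : ∀ y k, side T (f^[k] (f y)) (f^[k] y) ⊆ side T (f y) y := by
    intro y k
    induction k with
    | zero => exact subset_rfl
    | succ k ih =>
      refine subset_trans ?_ ih
      have := side_subset_of_ne hT (hadj (f^[k] y)) (hadj (f (f^[k] y))) (hne _)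
      simpa only [← Function.iterate_succ_apply, ← Function.iterate_succ_apply' f] using this
  have hlt : ∀ i j, i < j → f^[i] x ≠ f^[j] x := by
    intro i j hij heq
    obtain ⟨k, rfl⟩ := Nat.exists_eq_add_of_lt hij
    have h1 := hmono (f^[i] x) k (left_mem_side _ _)
    rw [← Function.iterate_succ_apply, ← Function.iterate_add_apply,
      show k.succ + i = i + k + 1 by omega, ← heq] at h1
    exact right_notMem_side hT (hadj _) h1
  intro i j hij
  rcases lt_trichotomy i j with h | h | h
  · exact absurd hij (hlt i j h)
  · exact h
  · exact absurd hij.symm (hlt j i h)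

/-- A map that moves every vertex towards a common end and commutes with `G` yields an end
fixed by `G`. -/
theorem fixesEnd_of_equivariant (hT : T.IsTree) {G : Subgroup (T ≃g T)} {f : V → V}
    (hadj : ∀ x, T.Adj (f x) x) (hne : ∀ x, f (f x) ≠ x)
    (hor : ∀ x y, T.Adj x y → f x = y ∨ f y = x) (heq : ∀ g ∈ G, ∀ x, f (g x) = g (f x)) :
    FixesEnd G := by
  obtain ⟨x₀⟩ := hT.connected.nonempty
  let r : Ray T := ⟨fun i => f^[i] x₀, injective_iterate hT hadj hne x₀, fun i => by
    have := (hadj (f^[i] x₀)).symm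
    rwa [← Function.iterate_succ_apply' f] at this⟩
  refine ⟨r, fun g hg => ⟨r, ?_, ?_⟩⟩
  -- Any two forward orbits of `f` merge, so the ray and its image share a tail.
  · have hmerge : ∀ y, ∃ i j, f^[i] x₀ = f^[j] y := by
      refine adj_induction hT x₀ ⟨0, 0, rfl⟩ ?_
      rintro x y hxy ⟨i, j, hij⟩
      rcases hor x y hxy with h | h
      · refine ⟨i + 1, j, ?_⟩
        rw [← h, ← Function.iterate_succ_apply, Function.iterate_succ_apply' f,
          Function.iterate_succ_apply' f, hij]
      · exact ⟨i, j + 1, by rw [Function.iterate_succ_apply, h, hij]⟩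
    have hit : ∀ i, f^[i] (g x₀) = g (f^[i] x₀) := by
      intro i
      induction i with
      | zero => rfl
      | succ i ih => rw [Function.iterate_succ_apply' f, ih, heq g hg,
          Function.iterate_succ_apply' f]
    obtain ⟨i, j, hij⟩ := hmerge (g x₀)
    refine (Set.infinite_range_of_injective
      (r.injective.comp (add_left_injective i))).mono ?_
    rintro _ ⟨k, rfl⟩
    refine ⟨⟨k + i, rfl⟩, k + j, ?_⟩
    change g (f^[k + j] x₀) = f^[k + i] x₀
    rw [← hit, Function.iterate_add_apply, ← hij, ← Function.iterate_add_apply]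
  · rw [Set.inter_self]
    exact Set.infinite_range_of_injective r.injective

/-- The group `H` moves every side of every edge off itself. -/
def FlipsSides (H : Subgroup (T ≃g T)) : Prop :=
  ∀ u v, T.Adj u v → ∃ h ∈ H, side T (h u) (h v) ⊆ side T v u

/-- If some side cannot be moved off itself, its translates meet pairwise. Those missing a vertex
`x` then all lie in one branch at `x`; stepping from `x` into that branch is a `G`-equivariant map,
whose orbits define a fixed end. -/
theorem flipsSides_of_noProperInvariantSubtree (hT : T.IsTree) {G : Subgroup (T ≃g T)}
    (hsub : NoProperInvariantSubtree G) (hend : ¬ FixesEnd G) : FlipsSides G := by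
  intro u v huv
  by_contra! hno
  apply hend
  have hmeet : ∀ g ∈ G, ∀ k ∈ G, ∃ y, y ∈ side T (g u) (g v) ∧ y ∈ side T (k u) (k v) := by
    intro g hg k hk
    obtain ⟨y, hy, hy'⟩ := Set.not_subset.1 (hno (g⁻¹ * k) (G.mul_mem (G.inv_mem hg) hk))
    refine ⟨g y, apply_mem_side_of_mem g ((mem_side_or hT u v y).resolve_right hy'), ?_⟩
    simpa using apply_mem_side_of_mem g hy
  have hmiss : ∀ x, ∃ g ∈ G, x ∉ side T (g u) (g v) := by
    intro x
    obtain ⟨g, hg, hgx⟩ := exists_apply_notMem_side hT hsub huv x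
    refine ⟨g⁻¹, G.inv_mem hg, ?_⟩
    rwa [mem_side_apply_iff, inv_inv]
  have hex : ∀ x, ∃ y, T.Adj y x ∧
      ∀ g ∈ G, x ∉ side T (g u) (g v) → side T (g u) (g v) ⊆ side T y x := by
    intro x
    obtain ⟨k, hk, hkx⟩ := hmiss x
    have hne : k u ≠ x := by
      rintro rfl
      exact hkx (left_mem_side _ _)
    obtain ⟨y, hy, hyk⟩ := exists_adj_mem_side hT hne
    have hss := side_subset_side hT hy hkx hyk
    refine ⟨y, hy, fun g hg hgx => ?_⟩
    obtain ⟨t, htg, htk⟩ := hmeet g hg k hk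
    exact side_subset_of_mem hT hy hgx htg (hss htk)
  choose f hadj hf using hex
  have huniq : ∀ x y, T.Adj y x → ∀ g ∈ G, x ∉ side T (g u) (g v) →
      ∀ t ∈ side T (g u) (g v), t ∈ side T y x → f x = y := fun x y hy g hg hgx t ht hty =>
    eq_of_mem_side_of_mem_side hT (hadj x) hy (hf x g hg hgx ht) hty
  refine fixesEnd_of_equivariant hT hadj ?_ ?_ ?_
  -- Backtracking would put a translate missing `x` and one missing `f x` on opposite sides of an
  -- edge, though they meet.
  · intro x hx
    obtain ⟨g, hg, hgx⟩ := hmiss x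
    obtain ⟨k, hk, hkx⟩ := hmiss (f x)
    obtain ⟨t, htg, htk⟩ := hmeet g hg k hk
    have h1 := hf x g hg hgx htg
    have h2 := hf (f x) k hk hkx htk
    rw [hx] at h2
    exact notMem_side_of_mem hT (hadj x) h1 h2
  · intro x y hxy
    by_contra! hne
    obtain ⟨g, hg, hgy⟩ := hmiss y
    have hxg : x ∉ side T (g u) (g v) := fun hxg =>
      hne.2 (huniq y x hxy g hg hgy x hxg (left_mem_side _ _))
    have hgu := hf x g hg hxg (left_mem_side _ _)
    exact hne.2 (huniq y x hxy g hg hgy (g u) (left_mem_side _ _)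
      (side_subset_of_ne hT hxy (hadj x) hne.1 hgu))
  · intro g hg x
    obtain ⟨k, hk, hkx⟩ := hmiss x
    have hku := hf x k hk hkx (left_mem_side _ _)
    refine huniq (g x) (g (f x)) (apply_adj g (hadj x)) (g * k) (G.mul_mem hg hk) ?_
      (g (k u)) (left_mem_side _ _) (apply_mem_side_of_mem g hku)
    exact fun h => hkx ((apply_mem_side_iff g).1 h)

/-- A group that flips all sides maps any side into any other side. -/
theorem FlipsSides.exists_side_subset (hT : T.IsTree) {H : Subgroup (T ≃g T)} (hH : FlipsSides H)
    {u v a b : V} (h : T.Adj u v) (hab : T.Adj a b) :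
    ∃ k ∈ H, side T (k u) (k v) ⊆ side T a b := by
  obtain ⟨k, hk, hku⟩ := hH u v h
  obtain ⟨l, hl, hla⟩ := hH b a hab.symm
  rcases side_nested hT h hab with hn | hn | hn | hn
  · exact ⟨1, H.one_mem, hn⟩
  · exact ⟨l, hl, (side_apply_subset l hn).trans hla⟩
  · exact ⟨k, hk, hku.trans hn⟩
  · exact ⟨l * k, H.mul_mem hl hk, (side_apply_subset l (hku.trans hn)).trans hla⟩

/-- If a subgroup normalized by a group that flips all sides moves some side off itself, then it
flips all sides. -/
theorem FlipsSides.of_normalized (hT : T.IsTree) {H N : Subgroup (T ≃g T)} (hH : FlipsSides H)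
    (hN : ∀ h ∈ H, ∀ n ∈ N, h * n * h⁻¹ ∈ N) {n : T ≃g T} (hn : n ∈ N) {u v : V} (h : T.Adj u v)
    (hnu : side T (n u) (n v) ⊆ side T v u) : FlipsSides N := by
  intro a b hab
  -- Reversing both edges makes the `k`-translate of `side T u v` contain `side T a b`.
  obtain ⟨k, hk, hkv⟩ := hH.exists_side_subset hT h.symm hab.symm
  refine ⟨k * n * k⁻¹, hN k hk n hn, ?_⟩
  have h1 : side T a b ⊆ side T (k u) (k v) := fun x hx => by
    rw [mem_side_swap_iff hT (apply_adj k h.symm)]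
    exact fun hx' => notMem_side_of_mem hT hab hx (hkv hx')
  have h2 := side_apply_subset (k * n * k⁻¹) h1
  have h3 : side T ((k * n * k⁻¹) (k u)) ((k * n * k⁻¹) (k v)) ⊆ side T (k v) (k u) := by
    simpa [RelIso.mul_apply] using side_apply_subset k hnu
  exact (h2.trans h3).trans hkv

/-! ### Branch vertices and the inheritance of flipping -/

/-- A vertex with at least three neighbours. -/
def IsBranchVertex (T : SimpleGraph V) (p : V) : Prop :=
  ∃ x y z, T.Adj x p ∧ T.Adj y p ∧ T.Adj z p ∧ x ≠ y ∧ x ≠ z ∧ y ≠ z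

/-- If `g` fixes `p` and some other vertex, but moves a neighbour of `p`, then `p` is a branch
vertex. -/
theorem isBranchVertex_of_apply_ne (hT : T.IsTree) {g : T ≃g T} {b p q : V} (hb : g b = b)
    (hp : g p = p) (hne : b ≠ p) (hqp : T.Adj q p) (hq : g q ≠ q) : IsBranchVertex T p := by
  obtain ⟨w, hw, hbw⟩ := exists_adj_mem_side hT hne
  have h1 := apply_adj g hw
  have h2 := apply_mem_side_of_mem g hbw
  have h3 := apply_adj g hqp
  rw [hp] at h1 h3
  rw [hp, hb] at h2
  have hgw : g w = w := eq_of_mem_side_of_mem_side hT h1 hw h2 hbw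
  refine ⟨w, q, g q, hw, hqp, h3, ?_, ?_, hq.symm⟩
  · rintro rfl
    exact hq hgw
  · intro h
    exact hq (by rw [← h]; exact g.injective (hgw.trans h))

theorem exists_apply_ne {H : Subgroup (T ≃g T)} (hH : H ≠ ⊥) : ∃ g ∈ H, ∃ x, g x ≠ x := by
  obtain ⟨g, hg, hne⟩ := H.ne_bot_iff_exists_ne_one.1 hH |>.elim fun g hg =>
    (⟨g, g.2, fun h => hg (Subtype.ext h)⟩ : ∃ g ∈ H, g ≠ 1)
  refine ⟨g, hg, ?_⟩
  by_contra! h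
  exact hne (RelIso.ext h)

/-- Under property H every side of every edge contains a branch vertex. -/
theorem exists_isBranchVertex_mem_side (hT : T.IsTree) [Infinite V] {G : Subgroup (T ≃g T)}
    (hsub : NoProperInvariantSubtree G) (hH : PropertyH G) {a b : V} (h : T.Adj a b) :
    ∃ p ∈ side T a b, IsBranchVertex T p := by
  obtain ⟨c, hc, hcb⟩ := exists_adj_ne hT hsub h
  obtain ⟨g, ⟨-, hg⟩, x, hx⟩ := exists_apply_ne (hH _ (isHalfTree_side hT hsub hc.symm))
  have hb : b ∈ side T a c :=
    side_subset_of_ne hT hc.symm h.symm hcb.symm (left_mem_side b a)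
  by_contra! hno
  -- Without branch vertices here, being fixed by `g` propagates from `a` along the side, which
  -- forces `g` to be trivial.
  have hfix : ∀ y ∈ side T a b, g y = y := by
    refine side_induction (hg a (left_mem_side a c)) fun p q hp _ hpq hgp => ?_
    by_contra hq
    refine hno p hp (isBranchVertex_of_apply_ne hT (hg b hb) hgp ?_ hpq.symm hq)
    rintro rfl
    exact right_notMem_side hT h hp
  rcases mem_side_or hT a c x with hx' | hx'
  · exact hx (hg x hx')
  · exact hx (hfix x (side_subset_of_ne hT h hc hcb hx'))

/-- A vertex separates the side of an incident edge from the rest of the tree. -/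
theorem dist_lt_of_notMem_side (hT : T.IsTree) {x y b z : V} (hy : T.Adj y x)
    (hb : b ∈ side T y x) (hz : z ∉ side T y x) (hne : z ≠ x) : T.dist b x < T.dist b z := by
  classical
  obtain ⟨p, hp⟩ := hT.connected.exists_walk_length_eq_dist b z
  have hmem : ∀ {b z : V} (p : T.Walk b z), b ∈ side T y x → z ∉ side T y x → x ∈ p.support := by
    intro b z p
    induction p with
    | nil => exact fun h h' => absurd h h'
    | @cons b c z hbc p ih =>
      intro hb hz
      rw [Walk.support_cons, List.mem_cons]
      by_cases hc : c ∈ side T y x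
      · exact Or.inr (ih hc hz)
      · obtain ⟨-, rfl⟩ := eq_of_adj_of_mem_side hT hy hb hc hbc
        exact Or.inr p.start_mem_support
  have hx := hmem p hb hz
  have hlen := congrArg Walk.length (p.take_spec hx)
  rw [Walk.length_append] at hlen
  have h1 := dist_le (p.takeUntil x hx)
  have h2 : (p.dropUntil x hx).length ≠ 0 := fun h0 => hne (Walk.eq_of_length_eq_zero h0).symm
  omega

theorem dist_apply (hT : T.IsTree) (g : T ≃g T) (x y : V) : T.dist (g x) (g y) = T.dist x y := by
  have key : ∀ (g : T ≃g T) (x y : V), T.dist (g x) (g y) ≤ T.dist x y := by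
    intro g x y
    obtain ⟨p, hp⟩ := hT.connected.exists_walk_length_eq_dist x y
    rw [← hp, ← Walk.length_map (g : T →g T) p]
    exact dist_le _
  refine le_antisymm (key g x y) ?_
  simpa using key g⁻¹ (g x) (g y)

/-- A branch vertex `p` in a branch at `x` away from `n x` is strictly closer to `x` than to `n x`,
so the isometry `n` cannot fix it. -/
theorem exists_isBranchVertex_apply_ne (hT : T.IsTree) [Infinite V] {G : Subgroup (T ≃g T)}
    (hsub : NoProperInvariantSubtree G) (hH : PropertyH G) {n : T ≃g T} {x : V} (hx : n x ≠ x) :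
    ∃ p, IsBranchVertex T p ∧ n p ≠ p := by
  obtain ⟨y, hy, hnx⟩ := exists_adj_mem_side hT hx
  obtain ⟨z, hz, hzy⟩ := exists_adj_ne hT hsub hy.symm
  have hnz : n x ∉ side T z x := fun h => hzy (eq_of_mem_side_of_mem_side hT hz hy h hnx)
  obtain ⟨p, hp, hbr⟩ := exists_isBranchVertex_mem_side hT hsub hH hz
  refine ⟨p, hbr, fun hnp => ?_⟩
  have h1 := dist_lt_of_notMem_side hT hz hp hnz hx
  have h2 := dist_apply hT n p x
  rw [hnp] at h2
  omega

/-- An automorphism that moves a branch vertex moves some side off itself. -/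
theorem exists_side_subset_of_isBranchVertex (hT : T.IsTree) {n : T ≃g T} {p : V}
    (hp : IsBranchVertex T p) (hn : n p ≠ p) :
    ∃ u v, T.Adj u v ∧ side T (n u) (n v) ⊆ side T v u := by
  -- Pigeonhole: `n p` and `n⁻¹ p` occupy at most two of the three branches at `p`.
  obtain ⟨y, hy, h1, h2⟩ : ∃ y, T.Adj y p ∧ n p ∉ side T y p ∧ n⁻¹ p ∉ side T y p := by
    obtain ⟨x, y, z, hx, hy, hz, hxy, hxz, hyz⟩ := hp
    have h : ∀ t y z, T.Adj y p → T.Adj z p → y ≠ z → t ∈ side T y p → t ∉ side T z p :=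
      fun t y z hy hz hyz h1 h2 => hyz (eq_of_mem_side_of_mem_side hT hy hz h1 h2)
    by_contra! hno
    have hx' := hno x hx
    have hy' := hno y hy
    have hz' := hno z hz
    have a1 := h (n p) x y hx hy hxy
    have a2 := h (n p) x z hx hz hxz
    have a3 := h (n p) y z hy hz hyz
    have b1 := h (n⁻¹ p) x y hx hy hxy
    have b2 := h (n⁻¹ p) x z hx hz hxz
    have b3 := h (n⁻¹ p) y z hy hz hyz
    tauto
  refine ⟨y, p, hy, ?_⟩
  have hny := apply_adj n hy
  refine side_subset_side hT hy.symm ?_ ?_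
  · intro hmem
    have hp' : p ∉ side T (n y) (n p) := by rwa [mem_side_apply_iff]
    exact hn (eq_of_adj_of_mem_side hT hny hmem hp' hy).2.symm
  · rw [mem_side_swap_iff hT hy]
    intro hmem
    exact hn (eq_of_adj_of_mem_side hT hy hmem h1 hny).2

/-- Non-trivial subgroups normalized by a group that flips all sides flip all sides. -/
theorem FlipsSides.of_ne_bot (hT : T.IsTree) [Infinite V] {G H N : Subgroup (T ≃g T)}
    (hsub : NoProperInvariantSubtree G) (hPH : PropertyH G) (hH : FlipsSides H)
    (hN : ∀ h ∈ H, ∀ n ∈ N, h * n * h⁻¹ ∈ N) (hne : N ≠ ⊥) : FlipsSides N := by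
  obtain ⟨n, hn, x, hx⟩ := exists_apply_ne hne
  obtain ⟨p, hp, hnp⟩ := exists_isBranchVertex_apply_ne hT hsub hPH hx
  obtain ⟨u, v, huv, hss⟩ := exists_side_subset_of_isBranchVertex hT hp hnp
  exact hH.of_normalized hT hN hn huv hss

/-! ### Approximation by commutators and the group `G⁺⁺` -/

/-- In a tree without leaves some side avoids a given finite set. -/
theorem exists_side_disjoint (hT : T.IsTree) [Infinite V] {G : Subgroup (T ≃g T)}
    (hsub : NoProperInvariantSubtree G) (F : Finset V) :
    ∃ c d, T.Adj c d ∧ ∀ x ∈ F, x ∉ side T c d := by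
  classical
  induction F using Finset.induction_on with
  | empty =>
    obtain ⟨u, v, h⟩ := exists_adj hT
    exact ⟨u, v, h, by simp⟩
  | insert f F _ ih =>
    obtain ⟨c, d, hcd, hF⟩ := ih
    by_cases hf : f ∈ side T c d
    · have hdf : d ≠ f := by
        rintro rfl
        exact right_notMem_side hT hcd hf
      obtain ⟨y, hy, hdy⟩ := exists_adj_mem_side hT hdf
      -- A branch at `f` away from `d` stays inside `side T c d` and drops `f`.
      obtain ⟨w, hw, hwy⟩ := exists_adj_ne hT hsub hy.symm
      have hdw : d ∉ side T w f := fun h => hwy (eq_of_mem_side_of_mem_side hT hw hy h hdy)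
      have hwc : w ∈ side T c d := by
        by_contra hwc
        obtain ⟨-, rfl⟩ := eq_of_adj_of_mem_side hT hcd hf hwc hw.symm
        exact hdw (left_mem_side _ _)
      have hss := side_subset_side hT hcd hdw hwc
      refine ⟨w, f, hw, fun x hx hxw => ?_⟩
      rcases Finset.mem_insert.1 hx with rfl | hx
      · exact right_notMem_side hT hw hxw
      · exact hF x hx (hss hxw)
    · refine ⟨c, d, hcd, fun x hx => ?_⟩
      rcases Finset.mem_insert.1 hx with rfl | hx
      · exact hf
      · exact hF x hx

theorem mem_closure_of_forall_finset {S : Set (T ≃g T)} {g : T ≃g T}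
    (h : ∀ F : Finset V, ∃ n ∈ S, ∀ x ∈ F, n x = g x) : g ∈ closure S := by
  let _ : TopologicalSpace V := ⊥
  rw [mem_closure_iff]
  rintro _ ⟨U, hU, rfl⟩ hgU
  obtain ⟨F, u, hu, hFU⟩ := isOpen_pi_iff.1 hU _ hgU
  obtain ⟨n, hn, hng⟩ := h F
  refine ⟨n, hFU fun x hx => ?_, hn⟩
  change n x ∈ u x
  rw [hng x hx]
  exact (hu x hx).2

/-- The subgroup generated by the pointwise stabilizers in `G` of all half-trees. -/
def halfTreeSubgroup (G : Subgroup (T ≃g T)) : Subgroup (T ≃g T) :=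
  Subgroup.closure {g | ∃ A : Set V, IsHalfTree T A ∧ g ∈ pointwiseStabilizer G A}

theorem halfTreeSubgroup_le_plusPlus (G : Subgroup (T ≃g T)) :
    halfTreeSubgroup G ≤ plusPlus G :=
  Subgroup.le_topologicalClosure _

theorem plusPlus_le_of_isClosed {G N : Subgroup (T ≃g T)} (hN : IsClosed (N : Set (T ≃g T)))
    (h : ∀ A : Set V, IsHalfTree T A → pointwiseStabilizer G A ≤ N) : plusPlus G ≤ N := by
  refine Subgroup.topologicalClosure_minimal _ ?_ hN
  rw [Subgroup.closure_le]
  rintro g ⟨A, hA, hg⟩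
  exact h A hA hg

theorem mem_halfTreeSubgroup {G : Subgroup (T ≃g T)} {A : Set V} (hA : IsHalfTree T A)
    {g : T ≃g T} (hg : g ∈ pointwiseStabilizer G A) : g ∈ halfTreeSubgroup G :=
  Subgroup.subset_closure ⟨A, hA, hg⟩

theorem halfTreeSubgroup_ne_bot (hT : T.IsTree) [Infinite V] {G : Subgroup (T ≃g T)}
    (hsub : NoProperInvariantSubtree G) (hH : PropertyH G) : halfTreeSubgroup G ≠ ⊥ := by
  obtain ⟨u, v, h⟩ := exists_adj hT
  have hA := isHalfTree_side hT hsub h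
  exact fun hbot => hH _ hA (le_bot_iff.1 fun g hg => hbot ▸ mem_halfTreeSubgroup hA hg)

theorem conj_mem_halfTreeSubgroup (hT : T.IsTree) [Infinite V] {G : Subgroup (T ≃g T)}
    (hsub : NoProperInvariantSubtree G) {h : T ≃g T} (hh : h ∈ G) {n : T ≃g T}
    (hn : n ∈ halfTreeSubgroup G) : h * n * h⁻¹ ∈ halfTreeSubgroup G := by
  have hle : halfTreeSubgroup G ≤
      (halfTreeSubgroup G).comap (MulAut.conj h).toMonoidHom := by
    rw [halfTreeSubgroup, Subgroup.closure_le]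
    rintro g ⟨A, hA, hgG, hg⟩
    obtain ⟨u, v, huv, rfl⟩ := hA.exists_eq_side hT
    refine mem_halfTreeSubgroup (isHalfTree_side hT hsub (apply_adj h huv))
      ⟨G.mul_mem (G.mul_mem hh hgG) (G.inv_mem hh), fun x hx => ?_⟩
    rw [mem_side_apply_iff] at hx
    change h (g (h⁻¹ x)) = x
    rw [hg _ hx, RelIso.apply_inv_self]
  exact hle hn

/-- A closed subgroup that flips all sides and is normalized by `G⁺⁺` contains the pointwise
stabilizers of half-trees: commutators with suitable elements approximate any element of such a
stabilizer. -/
theorem FlipsSides.pointwiseStabilizer_le (hT : T.IsTree) [Infinite V] {G N : Subgroup (T ≃g T)}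
    (hsub : NoProperInvariantSubtree G) (hN : IsClosed (N : Set (T ≃g T))) (hflip : FlipsSides N)
    (hnorm : ∀ g ∈ halfTreeSubgroup G, ∀ n ∈ N, g * n * g⁻¹ ∈ N) {A : Set V}
    (hA : IsHalfTree T A) : pointwiseStabilizer G A ≤ N := by
  intro g hg
  have hgK := mem_halfTreeSubgroup hA hg
  obtain ⟨u, v, huv, rfl⟩ := hA.exists_eq_side hT
  have hginv := (pointwiseStabilizer G (side T u v)).inv_mem hg
  rw [← SetLike.mem_coe, ← hN.closure_eq]
  refine mem_closure_of_forall_finset fun F => ?_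
  obtain ⟨c, d, hcd, hF⟩ := exists_side_disjoint hT hsub F
  obtain ⟨n, hn, hss⟩ := hflip.exists_side_subset hT huv.symm hcd
  refine ⟨g * n * g⁻¹ * n⁻¹, N.mul_mem (hnorm g hgK n hn) (N.inv_mem hn), fun x hx => ?_⟩
  have hx' : n⁻¹ x ∈ side T u v := by
    rw [mem_side_swap_iff hT huv.symm, ← mem_side_apply_iff]
    exact fun h => hF x hx (hss h)
  change g (n (g⁻¹ (n⁻¹ x))) = g x
  rw [hginv.2 _ hx', RelIso.apply_inv_self]

theorem IsHalfTree.infinite {A : Set V} (hA : IsHalfTree T A) : Infinite V := by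
  obtain ⟨e, -, ⟨C, -⟩, hinf⟩ := hA
  exact Set.infinite_univ_iff.1 ((hinf C).mono (Set.subset_univ _))

theorem plusPlus_le_of_normalized (hT : T.IsTree) {G : Subgroup (T ≃g T)}
    (hsub : NoProperInvariantSubtree G) (hend : ¬ FixesEnd G) (hH : PropertyH G)
    {N : Subgroup (T ≃g T)} (hN : IsClosed (N : Set (T ≃g T))) (hne : N ≠ ⊥)
    (hnorm : ∀ g ∈ plusPlus G, ∀ n ∈ N, g * n * g⁻¹ ∈ N) : plusPlus G ≤ N := by
  refine plusPlus_le_of_isClosed hN fun A hA => ?_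
  -- In a finite tree there are no half-trees, so there is nothing to prove.
  have : Infinite V := hA.infinite
  have hG := flipsSides_of_noProperInvariantSubtree hT hsub hend
  have hK : FlipsSides (halfTreeSubgroup G) :=
    hG.of_ne_bot hT hsub hH (fun h hh n hn => conj_mem_halfTreeSubgroup hT hsub hh hn)
      (halfTreeSubgroup_ne_bot hT hsub hH)
  have hnorm' : ∀ g ∈ halfTreeSubgroup G, ∀ n ∈ N, g * n * g⁻¹ ∈ N := fun g hg =>
    hnorm g (halfTreeSubgroup_le_plusPlus G hg)
  exact (hK.of_ne_bot hT hsub hH hnorm' hne).pointwiseStabilizer_le hT hsub hN hnorm' hA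

end TreeAut

open TreeAut in
theorem theorem6 {V : Type*} (T : SimpleGraph V) (hT : T.IsTree)
    (G : Subgroup (T ≃g T)) (hG : IsClosed (G : Set (T ≃g T)))
    (hsub : NoProperInvariantSubtree G) (hend : ¬ FixesEnd G) (hH : PropertyH G) :
    (∀ N : Subgroup (T ≃g T), N ≤ G → IsClosed (N : Set (T ≃g T)) → N ≠ ⊥ →
      (∀ g ∈ plusPlus G, ∀ n ∈ N, g * n * g⁻¹ ∈ N) → plusPlus G ≤ N) ∧
    (Infinite V → IsTopologicallySimple (plusPlus G)) := by
  refine ⟨fun N _ hN hne hnorm => plusPlus_le_of_normalized hT hsub hend hH hN hne hnorm,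
    fun _ => ⟨?_, fun N hNn hN => ?_⟩⟩
  · rw [Subgroup.nontrivial_iff_ne_bot]
    exact fun hbot => halfTreeSubgroup_ne_bot hT hsub hH
      (le_bot_iff.1 (hbot ▸ halfTreeSubgroup_le_plusPlus G))
  · refine or_iff_not_imp_left.2 fun hne => ?_
    have hcl : IsClosed (plusPlus G : Set (T ≃g T)) := Subgroup.isClosed_topologicalClosure _
    -- The image of `N` in `Aut T` is closed because `G⁺⁺` is, so the first part applies to it.
    have hle : plusPlus G ≤ N.map (plusPlus G).subtype := by
      refine plusPlus_le_of_normalized hT hsub hend hH ?_ ?_ ?_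
      · exact hcl.isClosedEmbedding_subtypeVal.isClosedMap _ hN
      · rwa [Ne, Subgroup.map_eq_bot_iff_of_injective _ (Subgroup.subtype_injective _)]
      · rintro g hg _ ⟨n, hn, rfl⟩
        exact ⟨⟨g, hg⟩ * n * ⟨g, hg⟩⁻¹, hNn.conj_mem n hn _, rfl⟩
    rw [Subgroup.eq_top_iff']
    intro x
    obtain ⟨y, hy, hyx⟩ := hle x.2
    rwa [← Subtype.ext hyx]
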